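/- Let $H$ be a complex Hilbert space, let $T$ be a bounded linear operator on $H$ with spectrum $\sigma(T)$, let $\delta\in[0,1)$, and put $$K_\delta=\Big\{x+iy:\ x,y\in\mathbb R,\ \frac{x^2}{(1+\delta)^2}+\frac{y^2}{(1-\delta)^2}\le 1\Big\},\qquad W(T)=\{\langle Tu,u\rangle:\ u\in H,\ \|u\|=1\},\qquad \mathbb D=\{z\in\mathbb C: |z|<1\}.$$ (i) Suppose $\sigma(T)\subseteq K_\delta$. Then $1-zT+\delta z^2$ is invertible for every $z\in\mathbb D$, and $W(T)\subseteq K_\delta$ if and only if there exist a complex Hilbert space $K$, a linear isometry $I:H\to K$ and a unitary operator $U$ on $K$ such that $$\bigl(1-\tfrac12 zT\bigr)\bigl(1-zT+\delta z^2\bigr)^{-1}=I^*(1-zU)^{-1}I\qquad\text{for all } z\in\mathbb D. \tag{$*$}$$ (ii) With no assumption on $\sigma(T)$: $W(T)\subseteq K_\delta$ if and only if $1-zT+\delta z^2$ is invertible for every $z\in\mathbb D$ and there exist $K$, $I$, $U$ as in (i) satisfying $(*)$. -/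

import Mathlib

universe u

namespace EllipseDilation

/-- The closed elliptical region with semi-axes `1 + δ` (real) and `1 - δ` (imaginary). -/
def ellipse (δ : ℝ) : Set ℂ :=
  {w : ℂ | w.re ^ 2 / (1 + δ) ^ 2 + w.im ^ 2 / (1 - δ) ^ 2 ≤ 1}

section Operators

variable {H : Type u} [NormedAddCommGroup H] [InnerProductSpace ℂ H]

/-- The numerical range of a bounded operator. Mathlib's inner product is linear in the second
variable, so `inner ℂ x (T x)` is what is usually written as `⟨T x, x⟩`. -/
def numericalRange (T : H →L[ℂ] H) : Set ℂ :=
  {w : ℂ | ∃ x : H, ‖x‖ = 1 ∧ inner ℂ x (T x) = w}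

/-- The operator `1 - z T + δ z²`. -/
noncomputable def denominator (δ : ℝ) (T : H →L[ℂ] H) (z : ℂ) : H →L[ℂ] H :=
  1 - z • T + ((δ : ℂ) * z ^ 2) • (1 : H →L[ℂ] H)

/-- The operator `F(z) = (1 - z T / 2) (1 - z T + δ z²)⁻¹`, the second factor being
the inverse in the ring of bounded operators (and `0` when there is none). -/
noncomputable def dilationFunction (δ : ℝ) (T : H →L[ℂ] H) (z : ℂ) : H →L[ℂ] H :=
  (1 - ((1 / 2 : ℂ) * z) • T) * Ring.inverse (denominator δ T z)

variable {K : Type u} [NormedAddCommGroup K] [InnerProductSpace ℂ K]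

/-- `F(z) = I* (1 - z U)⁻¹ I` on the open unit disc. For unitary `U` and `|z| < 1` the operator
`1 - z U` is always invertible. -/
def IsDilationFormula [CompleteSpace H] [CompleteSpace K] (δ : ℝ) (T : H →L[ℂ] H)
    (I : H →ₗᵢ[ℂ] K) (U : K →L[ℂ] K) : Prop :=
  ∀ z : ℂ, ‖z‖ < 1 →
    dilationFunction δ T z =
      ContinuousLinearMap.adjoint I.toContinuousLinearMap ∘L
        Ring.inverse (1 - z • U) ∘L I.toContinuousLinearMap

/-- There are a complex Hilbert space `K`, an isometry `I : H → K` and a unitary `U` on `K` such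
that `F(z) = I* (1 - z U)⁻¹ I` on the open unit disc. -/
def HasStrangeDilation [CompleteSpace H] (δ : ℝ) (T : H →L[ℂ] H) : Prop :=
  ∃ (K : Type u) (_ : NormedAddCommGroup K) (_ : InnerProductSpace ℂ K) (_ : CompleteSpace K)
    (I : H →ₗᵢ[ℂ] K) (U : K →L[ℂ] K),
    U ∈ unitary (K →L[ℂ] K) ∧ IsDilationFormula δ T I U

end Operators

end EllipseDilation

namespace EllipseDilation

open ComplexConjugate Filter MeasureTheory AddCircle
open scoped Topology

/-! Both conditions say that `F = dilationFunction δ T` has real part at least `1/2` on the disc.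
Write `D = denominator δ T z`. Since `2(1 - zT/2) - D = 1 - δz²`, substituting `x = D y` turns `2
Re⟨x, F x⟩ - ‖x‖²` into `Re(conj(1 - δz²)⟨y, D y⟩)` (`two_mul_inner_dilationFunction_sub`). For unit
`y` this is a scalar expression in `z` and the point `w = ⟨y, T y⟩` of the numerical range, and on
`|z| = 1` its nonnegativity is the supporting half-plane condition for the ellipse. So it is
nonnegative throughout the disc exactly when `w` lies in the ellipse.

The bound passes to a dilation by the operator Herglotz theorem: with `F 0 = 1`, it makes the Taylor
coefficients a positive Toeplitz kernel (`posSemidef_hermitianExtension`), and Naimark's theorem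
realises them as compressions of powers of a unitary. Conversely, `I* (1 - zU)⁻¹ I` satisfies the
bound by a direct norm estimate. -/

/-! ### Scalar geometry of the ellipse. -/

lemma re_conj_mul_symbol (δ : ℝ) (z w : ℂ) :
    (conj (1 - δ * z ^ 2) * (1 + δ * z ^ 2 - z * w)).re =
      1 - δ ^ 2 * (‖z‖ ^ 2) ^ 2 -
        ((1 - δ * ‖z‖ ^ 2) * (z.re * w.re) - (1 + δ * ‖z‖ ^ 2) * (z.im * w.im)) := by
  rw [← Complex.normSq_eq_norm_sq, Complex.normSq_apply]
  simp [pow_two]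
  ring

/-- On the ellipse the real part of `(1 + δ z² - z w) / (1 - δ z²)` has a positive lower bound
which does not depend on `w`. -/
lemma le_re_conj_mul_symbol {δ : ℝ} (hδ₀ : 0 ≤ δ) (hδ₁ : δ < 1) {z w : ℂ} (hz : ‖z‖ < 1)
    (hw : w ∈ ellipse δ) :
    (1 - δ * ‖z‖ ^ 2) * ((1 - ‖z‖) * (1 - δ * ‖z‖)) ≤
      (conj (1 - δ * z ^ 2) * (1 + δ * z ^ 2 - z * w)).re := by
  rw [re_conj_mul_symbol]
  have hab : z.re ^ 2 + z.im ^ 2 = ‖z‖ ^ 2 := by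
    rw [← Complex.normSq_eq_norm_sq, Complex.normSq_apply]; ring
  have hr := norm_nonneg z
  set r := ‖z‖
  have hp : 0 < 1 + δ := by linarith
  have hm : 0 < 1 - δ := by linarith
  have hr2 : r ^ 2 ≤ 1 := by nlinarith
  have hdr : δ * r ^ 2 ≤ δ := by nlinarith
  have hdr0 : 0 ≤ δ * r ^ 2 := by positivity
  obtain ⟨X, hX⟩ : ∃ X, w.re = (1 + δ) * X := ⟨w.re / (1 + δ), by field_simp⟩
  obtain ⟨Y, hY⟩ : ∃ Y, w.im = (1 - δ) * Y := ⟨w.im / (1 - δ), by field_simp⟩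
  have hXY : X ^ 2 + Y ^ 2 ≤ 1 := by
    have h : w.re ^ 2 / (1 + δ) ^ 2 + w.im ^ 2 / (1 - δ) ^ 2 ≤ 1 := hw
    rw [hX, hY] at h
    have h1 : ((1 + δ) * X) ^ 2 / (1 + δ) ^ 2 = X ^ 2 := by field_simp
    have h2 : ((1 - δ) * Y) ^ 2 / (1 - δ) ^ 2 = Y ^ 2 := by field_simp
    rwa [h1, h2] at h
  rw [hX, hY]
  set B := (1 - δ * r ^ 2) * (1 + δ)
  set C := (1 + δ * r ^ 2) * (1 - δ)
  have hC : 0 ≤ C := by positivity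
  have hCB : C ≤ B := by simp only [B, C]; nlinarith
  have hB : 0 ≤ B := hC.trans hCB
  -- Cauchy–Schwarz with `C ≤ B`. The stated constant is what remains: `1 - δ²r⁴ - B r = (1 - δr²)(1
  -- - r)(1 - δr)`.
  have key : B * z.re * X - C * z.im * Y ≤ B * r := by
    apply abs_le_of_sq_le_sq' _ (by positivity) |>.2
    calc (B * z.re * X - C * z.im * Y) ^ 2
        ≤ ((B * z.re) ^ 2 + (C * z.im) ^ 2) * (X ^ 2 + Y ^ 2) := by
          nlinarith [sq_nonneg (B * z.re * Y + C * z.im * X)]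
      _ ≤ ((B * z.re) ^ 2 + (C * z.im) ^ 2) * 1 := by gcongr
      _ ≤ (B * z.re) ^ 2 + (B * z.im) ^ 2 := by
          rw [mul_one, mul_pow C, mul_pow B z.im]; gcongr
      _ = (B * r) ^ 2 := by rw [mul_pow B r, ← hab]; ring
  simp only [B, C] at key
  nlinarith [key]

lemma symbol_bound_pos {δ : ℝ} (hδ₀ : 0 ≤ δ) (hδ₁ : δ < 1) {z : ℂ} (hz : ‖z‖ < 1) :
    0 < (1 - δ * ‖z‖ ^ 2) * ((1 - ‖z‖) * (1 - δ * ‖z‖)) := by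
  have hr := norm_nonneg z
  have h1 : δ * ‖z‖ ^ 2 < 1 := by nlinarith
  have h2 : δ * ‖z‖ < 1 := by nlinarith
  have h3 : 0 < 1 - δ * ‖z‖ ^ 2 := by linarith
  have h4 : 0 < 1 - ‖z‖ := by linarith
  have h5 : 0 < 1 - δ * ‖z‖ := by linarith
  positivity

/-- By continuity the inequality extends to the unit circle, where it reads `(1 - δ²)(1 - (X Re z -
Y Im z)) ≥ 0` in the rescaled coordinates `X`, `Y` of `w`; the best `z` is the direction of `X -
iY`. -/
lemma mem_ellipse_of_forall_re_conj_mul_symbol_nonneg {δ : ℝ} (hδ₀ : 0 ≤ δ) (hδ₁ : δ < 1) {w : ℂ}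
    (h : ∀ z : ℂ, ‖z‖ < 1 → 0 ≤ (conj (1 - δ * z ^ 2) * (1 + δ * z ^ 2 - z * w)).re) :
    w ∈ ellipse δ := by
  have hp : 0 < 1 + δ := by linarith
  have hm : 0 < 1 - δ := by linarith
  have hcl : ∀ z : ℂ, ‖z‖ = 1 → 0 ≤ (conj (1 - δ * z ^ 2) * (1 + δ * z ^ 2 - z * w)).re := by
    intro z hz
    have hmem : z ∈ closure (Metric.ball (0 : ℂ) 1) := by
      rw [closure_ball _ one_ne_zero]; simp [hz]
    refine closure_minimal (s := Metric.ball (0 : ℂ) 1)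
      (t := {z : ℂ | 0 ≤ (conj (1 - δ * z ^ 2) * (1 + δ * z ^ 2 - z * w)).re}) ?_ ?_ hmem
    · intro z hz
      exact h z (by simpa using hz)
    · exact isClosed_le continuous_const (by fun_prop)
  obtain ⟨X, hX⟩ : ∃ X, w.re = (1 + δ) * X := ⟨w.re / (1 + δ), by field_simp⟩
  obtain ⟨Y, hY⟩ : ∃ Y, w.im = (1 - δ) * Y := ⟨w.im / (1 - δ), by field_simp⟩
  change w.re ^ 2 / (1 + δ) ^ 2 + w.im ^ 2 / (1 - δ) ^ 2 ≤ 1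
  have h1 : ((1 + δ) * X) ^ 2 / (1 + δ) ^ 2 = X ^ 2 := by field_simp
  have h2 : ((1 - δ) * Y) ^ 2 / (1 - δ) ^ 2 = Y ^ 2 := by field_simp
  rw [hX, hY, h1, h2]
  set v : ℂ := ⟨X, -Y⟩
  have hv : ‖v‖ ^ 2 = X ^ 2 + Y ^ 2 := by
    rw [← Complex.normSq_eq_norm_sq, Complex.normSq_apply]; simp [v]; ring
  rcases eq_or_ne ‖v‖ 0 with h0 | h0
  · rw [← hv, h0]; norm_num
  have hvpos : 0 < ‖v‖ := lt_of_le_of_ne (norm_nonneg _) h0.symm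
  have hu : ‖((‖v‖⁻¹ : ℝ) : ℂ) * v‖ = 1 := by
    rw [norm_mul, Complex.norm_real, norm_inv, norm_norm, inv_mul_cancel₀ h0]
  have := hcl _ hu
  rw [re_conj_mul_symbol, hu, Complex.re_ofReal_mul, Complex.im_ofReal_mul, hX, hY] at this
  have e : 1 - δ ^ 2 * (1 ^ 2) ^ 2 - ((1 - δ * 1 ^ 2) * (‖v‖⁻¹ * v.re * ((1 + δ) * X)) -
      (1 + δ * 1 ^ 2) * (‖v‖⁻¹ * v.im * ((1 - δ) * Y))) =
      (1 + δ) * (1 - δ) * (1 - ‖v‖⁻¹ * ‖v‖ ^ 2) := by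
    rw [hv]; simp only [v]; ring
  rw [e] at this
  have h3 := nonneg_of_mul_nonneg_right this (by positivity)
  have h4 : ‖v‖⁻¹ * ‖v‖ ^ 2 = ‖v‖ := by field_simp
  rw [← hv]
  have : ‖v‖ ≤ 1 := by linarith
  nlinarith

/-! ### Invertibility of the denominator and the real part of `F`. -/

section Operators

variable {H : Type u} [NormedAddCommGroup H] [InnerProductSpace ℂ H]

local notation "⟪" x ", " y "⟫" => inner ℂ x y

lemma inner_denominator_apply (δ : ℝ) (T : H →L[ℂ] H) (z : ℂ) (x : H) :
    ⟪x, denominator δ T z x⟫ = (1 + δ * z ^ 2) * ‖x‖ ^ 2 - z * ⟪x, T x⟫ := by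
  simp only [denominator, add_apply, sub_apply,
    smul_apply, one_apply_eq_self, inner_add_right, inner_sub_right,
    inner_smul_right, inner_self_eq_norm_sq_to_K]
  simp
  ring

lemma le_re_conj_mul_inner_denominator {δ : ℝ} (hδ₀ : 0 ≤ δ) (hδ₁ : δ < 1) {T : H →L[ℂ] H}
    (hT : numericalRange T ⊆ ellipse δ) {z : ℂ} (hz : ‖z‖ < 1) (x : H) :
    (1 - δ * ‖z‖ ^ 2) * ((1 - ‖z‖) * (1 - δ * ‖z‖)) * ‖x‖ ^ 2 ≤
      (conj (1 - δ * z ^ 2) * ⟪x, denominator δ T z x⟫).re := by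
  rcases eq_or_ne x 0 with rfl | hx
  · simp
  have hx' : (‖x‖ : ℂ) ≠ 0 := by simpa using hx
  set y : H := ((‖x‖ : ℂ)⁻¹) • x
  have hy : ‖y‖ = 1 := by simp [y, norm_smul, hx]
  have hxy : x = (‖x‖ : ℂ) • y := by simp [y, smul_smul, hx']
  have hw := le_re_conj_mul_symbol hδ₀ hδ₁ hz (hT ⟨y, hy, rfl⟩)
  have e : ⟪x, T x⟫ = ‖x‖ ^ 2 * ⟪y, T y⟫ := by
    conv_lhs => rw [hxy]
    simp only [map_smul, inner_smul_left, inner_smul_right, Complex.conj_ofReal]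
    ring
  have e2 : conj (1 - δ * z ^ 2) * ⟪x, denominator δ T z x⟫ =
      ((‖x‖ ^ 2 : ℝ) : ℂ) * (conj (1 - δ * z ^ 2) * (1 + δ * z ^ 2 - z * ⟪y, T y⟫)) := by
    rw [inner_denominator_apply, e]; push_cast; ring
  rw [e2, Complex.re_ofReal_mul, mul_comm]
  gcongr

/-- For `z ≠ 0` the denominator is `z (l - T)` with `l = 1/z + δz`. The scalar symbol vanishes at `w
= l` but is strictly positive on the ellipse, so `l` lies outside it. -/
lemma isUnit_denominator_of_spectrum_subset {δ : ℝ} (hδ₀ : 0 ≤ δ) (hδ₁ : δ < 1)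
    {T : H →L[ℂ] H} (hT : spectrum ℂ T ⊆ ellipse δ) {z : ℂ} (hz : ‖z‖ < 1) :
    IsUnit (denominator δ T z) := by
  rcases eq_or_ne z 0 with rfl | hz0
  · simp [denominator]
  set l : ℂ := (1 + δ * z ^ 2) / z with hl
  have hlz : z * l = 1 + δ * z ^ 2 := by rw [hl]; field_simp
  have hmem : l ∉ spectrum ℂ T := fun h ↦ by
    have h1 := le_re_conj_mul_symbol hδ₀ hδ₁ hz (hT h)
    rw [hlz, sub_self, mul_zero, Complex.zero_re] at h1
    exact absurd h1 (not_le.2 (symbol_bound_pos hδ₀ hδ₁ hz))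
  have hu := spectrum.notMem_iff.1 hmem
  have e : denominator δ T z = (Units.mk0 z hz0) • (algebraMap ℂ (H →L[ℂ] H) l - T) := by
    rw [Units.smul_def, Units.val_mk0, smul_sub, Algebra.algebraMap_eq_smul_one, smul_smul, hlz,
      denominator, add_smul, one_smul]
    abel
  rw [e]
  exact hu.smul _

lemma two_mul_inner_dilationFunction_sub {δ : ℝ} {T : H →L[ℂ] H} {z : ℂ}
    (hu : IsUnit (denominator δ T z)) (y : H) :
    2 * (⟪denominator δ T z y, dilationFunction δ T z (denominator δ T z y)⟫).re -
        ‖denominator δ T z y‖ ^ 2 =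
      (conj (1 - δ * z ^ 2) * ⟪y, denominator δ T z y⟫).re := by
  have e1 : dilationFunction δ T z (denominator δ T z y) = y - ((1 / 2 : ℂ) * z) • T y := by
    have : dilationFunction δ T z * denominator δ T z = 1 - ((1 / 2 : ℂ) * z) • T := by
      rw [dilationFunction, mul_assoc, Ring.inverse_mul_cancel _ hu, mul_one]
    have := congrArg (fun A : H →L[ℂ] H ↦ A y) this
    simpa using this
  have e2 : (2 : ℂ) • (y - ((1 / 2 : ℂ) * z) • T y) - denominator δ T z y =
      (1 - δ * z ^ 2 : ℂ) • y := by
    simp only [denominator, add_apply, sub_apply,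
      smul_apply, one_apply_eq_self]
    module
  have e3 : (2 * ⟪denominator δ T z y, y - ((1 / 2 : ℂ) * z) • T y⟫ -
      ⟪denominator δ T z y, denominator δ T z y⟫) =
      conj (conj (1 - δ * z ^ 2) * ⟪y, denominator δ T z y⟫) := by
    rw [← inner_smul_right, ← inner_sub_right, e2, inner_smul_right, map_mul, Complex.conj_conj,
      inner_conj_symm]
  rw [e1, ← Complex.conj_re (conj _ * _), ← e3, inner_self_eq_norm_sq_to_K]
  simp [← Complex.ofReal_pow]

lemma dilationFunction_zero (δ : ℝ) (T : H →L[ℂ] H) : dilationFunction δ T 0 = 1 := by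
  simp [dilationFunction, denominator]

variable [CompleteSpace H]

/-- The scalar lower bound makes the denominator coercive, hence invertible as in Lax–Milgram; no
spectral hypothesis is needed. -/
lemma isUnit_denominator_of_numericalRange_subset {δ : ℝ} (hδ₀ : 0 ≤ δ) (hδ₁ : δ < 1)
    {T : H →L[ℂ] H} (hT : numericalRange T ⊆ ellipse δ) {z : ℂ} (hz : ‖z‖ < 1) :
    IsUnit (denominator δ T z) := by
  set c := (1 - δ * ‖z‖ ^ 2) * ((1 - ‖z‖) * (1 - δ * ‖z‖)) with hc
  have hc0 : 0 < c := symbol_bound_pos hδ₀ hδ₁ hz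
  have h2 : ‖conj (1 - δ * z ^ 2 : ℂ)‖ ≤ 2 := by
    rw [RCLike.norm_conj]
    refine (norm_sub_le _ _).trans ?_
    rw [norm_mul, norm_pow, Complex.norm_real, Real.norm_of_nonneg hδ₀, norm_one]
    nlinarith [norm_nonneg z]
  refine ContinuousLinearMap.isUnit_of_forall_le_norm_inner_map _ (c := ⟨c / 2, by positivity⟩)
    (half_pos hc0) fun x ↦ ?_
  have h1 := le_re_conj_mul_inner_denominator hδ₀ hδ₁ hT hz x
  have h3 := h1.trans (Complex.re_le_norm _)
  rw [norm_mul, ← hc] at h3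
  rw [norm_inner_symm]
  have h4 : c * ‖x‖ ^ 2 ≤ 2 * ‖⟪x, denominator δ T z x⟫‖ := h3.trans (by gcongr)
  change ‖x‖ ^ 2 * (c / 2) ≤ _
  linarith

lemma norm_sq_le_two_mul_inner_dilationFunction {δ : ℝ} (hδ₀ : 0 ≤ δ) (hδ₁ : δ < 1)
    {T : H →L[ℂ] H} (hT : numericalRange T ⊆ ellipse δ) {z : ℂ} (hz : ‖z‖ < 1) (x : H) :
    ‖x‖ ^ 2 ≤ 2 * (⟪x, dilationFunction δ T z x⟫).re := by
  have hu := isUnit_denominator_of_numericalRange_subset hδ₀ hδ₁ hT hz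
  obtain ⟨y, rfl⟩ : ∃ y, denominator δ T z y = x :=
    ⟨Ring.inverse (denominator δ T z) x, by
      rw [← mul_apply_eq_comp, Ring.mul_inverse_cancel _ hu]; simp⟩
  have h1 := two_mul_inner_dilationFunction_sub hu y
  have h2 := le_re_conj_mul_inner_denominator hδ₀ hδ₁ hT hz y
  have h3 := mul_nonneg (symbol_bound_pos hδ₀ hδ₁ hz).le (sq_nonneg ‖y‖)
  linarith

lemma differentiableOn_dilationFunction {δ : ℝ} {T : H →L[ℂ] H}
    (hu : ∀ z : ℂ, ‖z‖ < 1 → IsUnit (denominator δ T z)) :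
    DifferentiableOn ℂ (dilationFunction δ T) (Metric.ball 0 1) := by
  intro z hz
  refine DifferentiableAt.differentiableWithinAt ?_
  obtain ⟨v, hv⟩ := hu z (by simpa using hz)
  have hinv : DifferentiableAt ℂ (Ring.inverse : (H →L[ℂ] H) → _) (denominator δ T z) :=
    hv ▸ differentiableAt_inverse v.isUnit
  have hden : DifferentiableAt ℂ (denominator δ T) z := by
    unfold denominator; fun_prop
  have hnum : DifferentiableAt ℂ (fun z : ℂ ↦ (1 : H →L[ℂ] H) - ((1 / 2 : ℂ) * z) • T) z := by
    fun_prop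
  exact hnum.mul (hinv.comp z hden)

section Unitary

variable {K : Type u} [NormedAddCommGroup K] [InnerProductSpace ℂ K] [CompleteSpace K]

lemma norm_smul_lt_one_of_mem_unitary {U : K →L[ℂ] K} (hU : U ∈ unitary (K →L[ℂ] K)) {z : ℂ}
    (hz : ‖z‖ < 1) : ‖z • U‖ < 1 := by
  have hU1 : ‖U‖ ≤ 1 := U.opNorm_le_bound zero_le_one fun x ↦ by
    rw [one_mul]
    exact (ContinuousLinearMap.norm_map_of_mem_unitary hU x).le
  rw [norm_smul]
  nlinarith [norm_nonneg z, norm_nonneg U]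

/-- With `v = (1 - zU)⁻¹ I x`, one has `‖v - I x‖ = ‖z U v‖ ≤ ‖v‖`; expanding the square gives the
claim. -/
lemma norm_sq_le_two_mul_inner_of_isDilationFormula {δ : ℝ} {T : H →L[ℂ] H} {I : H →ₗᵢ[ℂ] K}
    {U : K →L[ℂ] K} (hU : U ∈ unitary (K →L[ℂ] K)) (h : IsDilationFormula δ T I U) {z : ℂ}
    (hz : ‖z‖ < 1) (x : H) : ‖x‖ ^ 2 ≤ 2 * (⟪x, dilationFunction δ T z x⟫).re := by
  have hu : IsUnit (1 - z • U) :=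
    isUnit_one_sub_of_norm_lt_one (norm_smul_lt_one_of_mem_unitary hU hz)
  set v : K := Ring.inverse (1 - z • U) (I x)
  have hv : I x = v - z • U v := by
    have := congrArg (fun A : K →L[ℂ] K ↦ A (I x)) (Ring.mul_inverse_cancel _ hu)
    simpa [v] using this.symm
  have e : ⟪x, dilationFunction δ T z x⟫ = ⟪I x, v⟫ := by
    rw [h z hz]
    simp [ContinuousLinearMap.adjoint_inner_right, v]
  have hp : ‖z • U v‖ ≤ ‖v‖ := by
    rw [norm_smul, ContinuousLinearMap.norm_map_of_mem_unitary hU]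
    nlinarith [norm_nonneg v]
  have h1 : ‖v - I x‖ ^ 2 = ‖v‖ ^ 2 - 2 * (⟪v, I x⟫).re + ‖I x‖ ^ 2 := norm_sub_sq (𝕜 := ℂ) _ _
  have h2 : v - I x = z • U v := by rw [hv]; abel
  rw [h2] at h1
  have h3 : (⟪v, I x⟫).re = (⟪I x, v⟫).re := by rw [← inner_conj_symm, Complex.conj_re]
  rw [e, ← I.norm_map x]
  have h4 : ‖z • U v‖ ^ 2 ≤ ‖v‖ ^ 2 := by gcongr
  linarith

end Unitary

lemma numericalRange_subset_of_hasStrangeDilation {δ : ℝ} (hδ₀ : 0 ≤ δ) (hδ₁ : δ < 1)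
    {T : H →L[ℂ] H} (hu : ∀ z : ℂ, ‖z‖ < 1 → IsUnit (denominator δ T z))
    (h : HasStrangeDilation δ T) : numericalRange T ⊆ ellipse δ := by
  obtain ⟨K, _, _, _, I, U, hU, hI⟩ := h
  rintro w ⟨x, hx, rfl⟩
  refine mem_ellipse_of_forall_re_conj_mul_symbol_nonneg hδ₀ hδ₁ fun z hz ↦ ?_
  have h1 := norm_sq_le_two_mul_inner_of_isDilationFormula hU hI hz (denominator δ T z x)
  have h2 := two_mul_inner_dilationFunction_sub (hu z hz) x
  rw [inner_denominator_apply, hx] at h2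
  simp only [Complex.ofReal_one, one_pow, mul_one] at h2
  linarith

end Operators

/-! ### Naimark dilation from a reproducing kernel space. -/

lemma norm_linearCombination_congr {ι E : Type*} [NormedAddCommGroup E] [InnerProductSpace ℂ E]
    {a b : ι → E} (h : ∀ i j, inner ℂ (a i) (a j) = inner ℂ (b i) (b j)) (f : ι →₀ ℂ) :
    ‖Finsupp.linearCombination ℂ a f‖ = ‖Finsupp.linearCombination ℂ b f‖ := by
  have : inner ℂ (Finsupp.linearCombination ℂ a f) (Finsupp.linearCombination ℂ a f) =
      inner ℂ (Finsupp.linearCombination ℂ b f) (Finsupp.linearCombination ℂ b f) := by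
    simp only [Finsupp.linearCombination_apply, Finsupp.sum, sum_inner, inner_sum,
      inner_smul_left, inner_smul_right, h]
  rw [@norm_eq_sqrt_re_inner ℂ, this, ← @norm_eq_sqrt_re_inner ℂ]

section Naimark

variable {H : Type u} [NormedAddCommGroup H] [InnerProductSpace ℂ H] [CompleteSpace H]

local notation "⟪" x ", " y "⟫" => inner ℂ x y

/-- **Naimark's dilation theorem** for the group `ℤ`. -/
theorem exists_unitary_dilation_of_posSemidef (A : ℤ → H →L[ℂ] H) (h0 : A 0 = 1)
    (hA : (Matrix.of fun i j : ℤ ↦ A (j - i)).PosSemidef) :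
    ∃ (K : Type u) (_ : NormedAddCommGroup K) (_ : InnerProductSpace ℂ K) (_ : CompleteSpace K)
      (I : H →ₗᵢ[ℂ] K) (U : K →L[ℂ] K), U ∈ unitary (K →L[ℂ] K) ∧
      ∀ (n : ℕ) (x y : H), ⟪I x, (U ^ n) (I y)⟫ = ⟪x, A n y⟫ := by
  set M : Matrix ℤ ℤ (H →L[ℂ] H) := Matrix.of fun i j : ℤ ↦ A (j - i) with hM
  have : Fact M.PosSemidef := ⟨hA⟩
  let K := RKHS.OfKernel M
  let k : ℤ → H →L[ℂ] K := RKHS.kerFun K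
  have hk : ∀ (i j : ℤ) (v w : H), ⟪k i v, k j w⟫ = ⟪v, A (j - i) w⟫ := by
    intro i j v w
    refine (RKHS.kernel_inner K j i v w).symm.trans ?_
    have h := hA.isHermitian.apply j i
    rw [RKHS.OfKernel.kernel_ofKernel, ← h, ContinuousLinearMap.star_eq_adjoint,
      ContinuousLinearMap.adjoint_inner_left]
    rfl
  let e : (ℤ × H →₀ ℂ) →ₗ[ℂ] K := Finsupp.linearCombination ℂ fun p ↦ k p.1 p.2
  let s : (ℤ × H →₀ ℂ) ≃ₗ[ℂ] (ℤ × H →₀ ℂ) :=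
    Finsupp.domLCongr ((Equiv.addRight 1).prodCongr (Equiv.refl H))
  have he : DenseRange e := by
    have h := RKHS.kerFun_dense (H := K)
    rw [← Submodule.dense_iff_topologicalClosure_eq_top] at h
    refine h.mono ?_
    rw [← LinearMap.coe_range, SetLike.coe_subset_coe, Submodule.span_le]
    rintro _ ⟨i, v, rfl⟩
    exact ⟨Finsupp.single (i, v) 1, by simp [e, k]⟩
  -- The kernel depends only on `j - i`, so shifting indices preserves the Gram matrix of the kernel
  -- vectors.
  have hs : ∀ f, ‖e (s f)‖ = ‖e f‖ := by
    intro f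
    have h : e (s f) = Finsupp.linearCombination ℂ (fun p : ℤ × H ↦ k (p.1 + 1) p.2) f := by
      simp only [e, s, Finsupp.domLCongr_apply, Finsupp.domCongr_apply,
        Finsupp.linearCombination_equivMapDomain]
      rfl
    rw [h]
    exact norm_linearCombination_congr (fun p q ↦ by rw [hk, hk, add_sub_add_right_eq_sub]) f
  -- The extension is onto, not merely isometric, because the shift of `ℤ` is a bijection.
  let V : K ≃ₗᵢ[ℂ] K := s.extendOfIsometry e e he he hs
  have hV : ∀ (i : ℤ) (v : H), V (k i v) = k (i + 1) v := by
    intro i v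
    have h := s.extendOfIsometry_eq e e he he hs (Finsupp.single (i, v) 1)
    simpa [e, s, Finsupp.domLCongr_apply] using h
  let U := Unitary.linearIsometryEquiv.symm V
  have hU : ∀ (n : ℕ) (v : H), ((U : K →L[ℂ] K) ^ n) (k 0 v) = k n v := by
    intro n v
    induction n with
    | zero => simp
    | succ n ih =>
      rw [pow_succ', mul_apply_eq_comp, ih]
      exact (hV n v).trans (by push_cast; rfl)
  let I : H →ₗᵢ[ℂ] K :=
    { toLinearMap := (k 0).toLinearMap
      norm_map' := fun v ↦ by
        have h := hk 0 0 v v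
        rw [sub_zero, h0, one_apply_eq_self] at h
        rw [ContinuousLinearMap.coe_coe, @norm_eq_sqrt_re_inner ℂ, h,
          ← @norm_eq_sqrt_re_inner ℂ] }
  refine ⟨K, inferInstance, inferInstance, inferInstance, I, U, U.2, fun n x y ↦ ?_⟩
  change ⟪k 0 x, ((U : K →L[ℂ] K) ^ n) (k 0 y)⟫ = _
  rw [hU, hk, sub_zero]

end Naimark
-- Fourier coefficients on circles.
lemma integral_fourier (m : ℤ) :
    ∫ t : UnitAddCircle, fourier m t ∂haarAddCircle = if m = 0 then 1 else 0 := by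
  split_ifs with h
  · simp [h]
  · exact integral_eq_zero_of_add_right_eq_neg (μ := haarAddCircle)
      (fourier_add_half_inv_index h one_pos)

/-- The Fourier coefficients of the restriction of a power series to the circle of radius `r`. -/
lemma integral_fourier_mul_of_hasSum {f : UnitAddCircle → ℂ} {a : ℕ → ℂ} {r : ℝ} (hr : 0 ≤ r)
    (ha : Summable fun n ↦ ‖a n‖ * r ^ n)
    (hf : ∀ t, HasSum (fun n : ℕ ↦ a n * (r * fourier 1 t) ^ n) (f t)) (m : ℤ) :
    ∫ t, fourier (-m) t * f t ∂haarAddCircle = if 0 ≤ m then r ^ m.natAbs * a m.natAbs else 0 := by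
  have hpow : ∀ (n : ℕ) (t : UnitAddCircle),
      fourier (-m) t * (a n * (r * fourier 1 t) ^ n) = r ^ n * a n * fourier (n - m) t := by
    intro n t
    have h : (fourier 1 t : ℂ) ^ n = fourier (n : ℤ) t := by
      rw [fourier_one, fourier_apply, natCast_zsmul, toCircle_nsmul, Circle.coe_pow]
    rw [sub_eq_add_neg, fourier_add, mul_pow, h]
    ring
  have hsum : HasSum (fun n : ℕ ↦ ∫ t : UnitAddCircle, r ^ n * a n * fourier (n - m) t
      ∂haarAddCircle) (∫ t, fourier (-m) t * f t ∂haarAddCircle) := by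
    refine hasSum_integral_of_dominated_convergence (fun n _ ↦ ‖a n‖ * r ^ n)
      (fun n ↦ (by fun_prop : Continuous _).aestronglyMeasurable) (fun n ↦ ae_of_all _ fun t ↦ ?_)
      (ae_of_all _ fun _ ↦ ha) (integrable_const _) (ae_of_all _ fun t ↦ ?_)
    · rw [norm_mul, fourier_apply, Circle.norm_coe, norm_mul, norm_pow, Complex.norm_real,
        Real.norm_of_nonneg hr, mul_one, mul_comm]
    · simpa only [hpow] using (hf t).mul_left (fourier (-m) t : ℂ)
  simp only [integral_const_mul, integral_fourier] at hsum
  refine hsum.unique ?_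
  split_ifs with hm
  · obtain ⟨k, rfl⟩ := Int.eq_ofNat_of_zero_le hm
    convert! hasSum_single (f := fun n : ℕ ↦ (r : ℂ) ^ n * a n * if (n : ℤ) - k = 0 then 1 else 0)
      k ?_ using 1
    · simp
    · intro n hn
      rw [if_neg (by omega), mul_zero]
  · convert! (hasSum_zero : HasSum (fun _ : ℕ ↦ (0 : ℂ)) 0) using 2 with n
    rw [if_neg (by omega), mul_zero]

/-! ### Operator-valued Herglotz representation. -/

section Herglotz

variable {H : Type u} [NormedAddCommGroup H] [InnerProductSpace ℂ H]

local notation "⟪" x ", " y "⟫" => inner ℂ x y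

/-- This exhibits the integrand of the Toeplitz form as a quadratic form of `Q`, so pointwise
positivity of `Q` suffices. -/
lemma sum_sum_fourier_mul_inner (s : Finset ℤ) (v : ℤ → H) (Q : H →L[ℂ] H) (t : UnitAddCircle) :
    ∑ i ∈ s, ∑ j ∈ s, fourier (-(i - j)) t * ⟪v j, Q (v i)⟫ =
      ⟪∑ i ∈ s, (fourier (-i) t : ℂ) • v i, Q (∑ i ∈ s, (fourier (-i) t : ℂ) • v i)⟫ := by
  simp only [map_sum, map_smul, inner_sum, sum_inner, inner_smul_left, inner_smul_right,
    ← fourier_neg, neg_neg]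
  refine Finset.sum_congr rfl fun i _ ↦ ?_
  rw [Finset.mul_sum]
  refine Finset.sum_congr rfl fun j _ ↦ ?_
  rw [neg_sub, sub_eq_add_neg, fourier_add]
  ring

variable [CompleteSpace H]

/-- The two-sided sequence extending `c` by `c (-n) = (c n)*`. -/
noncomputable def hermitianExtension (c : ℕ → H →L[ℂ] H) (m : ℤ) : H →L[ℂ] H :=
  if 0 ≤ m then c m.natAbs else ContinuousLinearMap.adjoint (c m.natAbs)

lemma adjoint_hermitianExtension {c : ℕ → H →L[ℂ] H} (h0 : c 0 = 1) (m : ℤ) :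
    ContinuousLinearMap.adjoint (hermitianExtension c m) = hermitianExtension c (-m) := by
  rcases lt_trichotomy m 0 with h | rfl | h
  · simp [hermitianExtension, h.not_ge, h.le]
  · simp [hermitianExtension, h0, ← ContinuousLinearMap.star_eq_adjoint]
  · simp [hermitianExtension, h.not_ge, h.le]

/-- `F` contributes the frequencies `m ≥ 0` and its adjoint those with `m ≤ 0`; subtracting `1`
corrects the double count at `m = 0`. -/
lemma integral_fourier_mul_inner {F : ℂ → H →L[ℂ] H} {c : ℕ → H →L[ℂ] H} (h0 : c 0 = 1)
    {r : ℝ} (hr : 0 ≤ r) (hc : Summable fun n ↦ ‖c n‖ * r ^ n)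
    (hF : ∀ z : ℂ, ‖z‖ = r → HasSum (fun n : ℕ ↦ z ^ n • c n) (F z))
    (hcont : Continuous fun t : UnitAddCircle ↦ F (r * fourier 1 t)) (m : ℤ) (x y : H) :
    ∫ t : UnitAddCircle, fourier (-m) t * ⟪x, (F (r * fourier 1 t) +
      ContinuousLinearMap.adjoint (F (r * fourier 1 t)) - 1) y⟫ ∂haarAddCircle =
      r ^ m.natAbs * ⟪x, hermitianExtension c m y⟫ := by
  have hz : ∀ t : UnitAddCircle, ‖(r * fourier 1 t : ℂ)‖ = r := fun t ↦ by
    rw [norm_mul, fourier_apply, Circle.norm_coe, mul_one, Complex.norm_real,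
      Real.norm_of_nonneg hr]
  have hsum : ∀ (x y : H) (t : UnitAddCircle),
      HasSum (fun n : ℕ ↦ ⟪x, c n y⟫ * (r * fourier 1 t) ^ n) ⟪x, F (r * fourier 1 t) y⟫ := by
    intro x y t
    have h := (hF _ (hz t)).mapL ((innerSL ℂ x).comp (ContinuousLinearMap.apply ℂ H y))
    simpa [inner_smul_right, mul_comm] using h
  have hsm : ∀ x y : H, Summable fun n ↦ ‖⟪x, c n y⟫‖ * r ^ n := by
    intro x y
    refine Summable.of_nonneg_of_le (fun n ↦ by positivity) (fun n ↦ ?_)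
      (hc.mul_left (‖x‖ * ‖y‖))
    calc ‖⟪x, c n y⟫‖ * r ^ n ≤ (‖x‖ * (‖c n‖ * ‖y‖)) * r ^ n := by
          gcongr
          exact (norm_inner_le_norm _ _).trans (by gcongr; exact (c n).le_opNorm y)
      _ = _ := by ring
  have hint : ∀ {g : UnitAddCircle → ℂ}, Continuous g → Integrable g haarAddCircle :=
    fun hg ↦ hg.integrable_of_hasCompactSupport (HasCompactSupport.of_compactSpace _)
  have h1 := integral_fourier_mul_of_hasSum hr (hsm x y) (hsum x y) m
  have h2 : ∫ t : UnitAddCircle, fourier (-m) t * conj ⟪y, F (r * fourier 1 t) x⟫ ∂haarAddCircle =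
      conj (if 0 ≤ -m then (r : ℂ) ^ (-m).natAbs * ⟪y, c (-m).natAbs x⟫ else 0) := by
    rw [← integral_fourier_mul_of_hasSum hr (hsm y x) (hsum y x) (-m), ← integral_conj]
    simp only [map_mul, ← fourier_neg, neg_neg]
  have h3 : ∫ t : UnitAddCircle, fourier (-m) t * ⟪x, y⟫ ∂haarAddCircle =
      if m = 0 then ⟪x, y⟫ else 0 := by
    rw [integral_mul_const, integral_fourier]
    simp
  have e : ∀ t : UnitAddCircle, fourier (-m) t * ⟪x, (F (r * fourier 1 t) +
      ContinuousLinearMap.adjoint (F (r * fourier 1 t)) - 1) y⟫ =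
      fourier (-m) t * ⟪x, F (r * fourier 1 t) y⟫ +
        fourier (-m) t * conj ⟪y, F (r * fourier 1 t) x⟫ - fourier (-m) t * ⟪x, y⟫ := by
    intro t
    rw [sub_apply, add_apply, one_apply_eq_self, inner_sub_right, inner_add_right,
      ContinuousLinearMap.adjoint_inner_right, inner_conj_symm]
    ring
  have hcx : ∀ x : H, Continuous fun t : UnitAddCircle ↦ F (r * fourier 1 t) x :=
    fun x ↦ hcont.clm_apply continuous_const
  have i1 : Continuous fun t : UnitAddCircle ↦ fourier (-m) t * ⟪x, F (r * fourier 1 t) y⟫ :=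
    (fourier (-m)).continuous.mul (continuous_const.inner (hcx y))
  have i2 : Continuous fun t : UnitAddCircle ↦
      fourier (-m) t * conj ⟪y, F (r * fourier 1 t) x⟫ :=
    (fourier (-m)).continuous.mul
      (Complex.continuous_conj.comp (continuous_const.inner (hcx x)))
  have i3 : Continuous fun t : UnitAddCircle ↦ fourier (-m) t * ⟪x, y⟫ :=
    (fourier (-m)).continuous.mul continuous_const
  have i12 : Continuous fun t : UnitAddCircle ↦ fourier (-m) t * ⟪x, F (r * fourier 1 t) y⟫ +
      fourier (-m) t * conj ⟪y, F (r * fourier 1 t) x⟫ := i1.add i2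
  simp only [e]
  rw [integral_sub (hint i12) (hint i3), integral_add (hint i1) (hint i2),
    h1, h2, h3]
  rcases lt_trichotomy m 0 with h | rfl | h
  · simp [hermitianExtension, h.not_ge, h.le, h.ne, ContinuousLinearMap.adjoint_inner_right]
  · simp [hermitianExtension, h0]
  · simp [hermitianExtension, h.not_ge, h.le, h.ne']

lemma re_inner_add_adjoint_sub_one (G : H →L[ℂ] H) (x : H) :
    (⟪x, (G + ContinuousLinearMap.adjoint G - 1) x⟫).re = 2 * (⟪x, G x⟫).re - ‖x‖ ^ 2 := by
  have h : (⟪G x, x⟫).re = (⟪x, G x⟫).re := by rw [← inner_conj_symm, Complex.conj_re]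
  rw [sub_apply, add_apply, one_apply_eq_self, inner_sub_right, inner_add_right,
    ContinuousLinearMap.adjoint_inner_right, inner_self_eq_norm_sq_to_K, Complex.sub_re,
    Complex.add_re, h, two_mul]
  simp [← Complex.ofReal_pow]

/-- The Taylor coefficients of a function with real part at least `1 / 2` define a positive
semidefinite Toeplitz kernel. -/
theorem posSemidef_hermitianExtension {F : ℂ → H →L[ℂ] H} {c : ℕ → H →L[ℂ] H} (h0 : c 0 = 1)
    (hc : ∀ r : ℝ, 0 ≤ r → r < 1 → Summable fun n ↦ ‖c n‖ * r ^ n)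
    (hF : ∀ z : ℂ, ‖z‖ < 1 → HasSum (fun n : ℕ ↦ z ^ n • c n) (F z))
    (hcont : ContinuousOn F (Metric.ball 0 1))
    (hpos : ∀ z : ℂ, ‖z‖ < 1 → ∀ x, ‖x‖ ^ 2 ≤ 2 * (⟪x, F z x⟫).re) :
    (Matrix.of fun i j : ℤ ↦ hermitianExtension c (j - i)).PosSemidef := by
  have tfae := (RKHS.posSemidef_tfae (𝕜 := ℂ)
    (K := Matrix.of fun i j : ℤ ↦ hermitianExtension c (j - i))).out 0 2
  rw [tfae]
  refine ⟨?_, fun v ↦ ?_⟩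
  · ext1 i j
    rw [Matrix.conjTranspose_apply, Matrix.of_apply, Matrix.of_apply,
      ContinuousLinearMap.star_eq_adjoint, adjoint_hermitianExtension h0, neg_sub]
  -- The Toeplitz form damped by `r ^ |i - j|`: for `r < 1` it is the integral of a nonnegative
  -- function over the circle of radius `r`, and `r → 1` gives the form itself.
  let g : ℝ → ℝ := fun r ↦ (∑ i ∈ v.support, ∑ j ∈ v.support,
    (r : ℂ) ^ (i - j).natAbs * ⟪v j, hermitianExtension c (i - j) (v i)⟫).re
  have hg : Continuous g := by fun_prop
  have hg0 : ∀ r ∈ Set.Ioo (0 : ℝ) 1, 0 ≤ g r := by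
    rintro r ⟨hr0, hr1⟩
    have hz : ∀ t : UnitAddCircle, ‖(r * fourier 1 t : ℂ)‖ < 1 := fun t ↦ by
      rwa [norm_mul, fourier_apply, Circle.norm_coe, mul_one, Complex.norm_real,
        Real.norm_of_nonneg hr0.le]
    have hFc : Continuous fun t : UnitAddCircle ↦ F (r * fourier 1 t) :=
      hcont.comp_continuous (by fun_prop) fun t ↦ by simpa using hz t
    set Q : UnitAddCircle → H →L[ℂ] H := fun t ↦ F (r * fourier 1 t) +
      ContinuousLinearMap.adjoint (F (r * fourier 1 t)) - 1 with hQ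
    have hQc : Continuous Q :=
      (hFc.add (ContinuousLinearMap.adjoint.continuous.comp hFc)).sub continuous_const
    have hint : ∀ {f : UnitAddCircle → ℂ}, Continuous f → Integrable f haarAddCircle :=
      fun hf ↦ hf.integrable_of_hasCompactSupport (HasCompactSupport.of_compactSpace _)
    have hterm : ∀ i j : ℤ, Continuous fun t : UnitAddCircle ↦
        fourier (-(i - j)) t * ⟪v j, Q t (v i)⟫ := fun i j ↦
      (fourier (-(i - j))).continuous.mul
        (continuous_const.inner (hQc.clm_apply continuous_const))
    have e : g r = (∫ t : UnitAddCircle, ∑ i ∈ v.support, ∑ j ∈ v.support,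
        fourier (-(i - j)) t * ⟪v j, Q t (v i)⟫ ∂haarAddCircle).re := by
      rw [integral_finsetSum _ fun i _ ↦ integrable_finsetSum _ fun j _ ↦ hint (hterm i j)]
      refine congrArg Complex.re (Finset.sum_congr rfl fun i _ ↦ ?_)
      rw [integral_finsetSum _ fun j _ ↦ hint (hterm i j)]
      refine Finset.sum_congr rfl fun j _ ↦ ?_
      exact (integral_fourier_mul_inner h0 hr0.le (hc r hr0.le hr1)
        (fun z hz ↦ hF z (hz.trans_lt hr1)) hFc (i - j) (v j) (v i)).symm
    have hsum : Continuous fun t : UnitAddCircle ↦ ∑ i ∈ v.support, ∑ j ∈ v.support,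
        fourier (-(i - j)) t * ⟪v j, Q t (v i)⟫ :=
      continuous_finsetSum _ fun i _ ↦ continuous_finsetSum _ fun j _ ↦ hterm i j
    rw [e, ← RCLike.re_eq_complex_re, ← integral_re (hint hsum)]
    refine integral_nonneg fun t ↦ ?_
    simp only [sum_sum_fourier_mul_inner, RCLike.re_eq_complex_re, Pi.zero_apply, hQ]
    rw [re_inner_add_adjoint_sub_one]
    linarith [hpos _ (hz t) (∑ i ∈ v.support, (fourier (-i) t : ℂ) • v i)]
  have hlim : 0 ≤ g 1 := by
    refine ge_of_tendsto ((hg.tendsto 1).mono_left (nhdsWithin_le_nhds (s := Set.Iio 1))) ?_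
    filter_upwards [Ioo_mem_nhdsLT (zero_lt_one' ℝ)] with r hr using hg0 r hr
  have hconj : v.sum (fun i w ↦ v.sum fun j w' ↦
      ⟪(Matrix.of fun i j : ℤ ↦ hermitianExtension c (j - i)) j i w, w'⟫) =
      conj (∑ i ∈ v.support, ∑ j ∈ v.support,
        ((1 : ℝ) : ℂ) ^ (i - j).natAbs * ⟪v j, hermitianExtension c (i - j) (v i)⟫) := by
    simp [Finsupp.sum, map_sum, inner_conj_symm]
  rw [hconj, RCLike.re_eq_complex_re, Complex.conj_re]
  exact hlim

/-- Convergence at some `ρ` between `r` and `1` bounds `‖c n‖ ρ ^ n`, leaving a geometric series of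
ratio `r / ρ`. -/
lemma summable_norm_mul_pow {E : Type*} [NormedAddCommGroup E] [NormedSpace ℂ E] {c : ℕ → E}
    (h : ∀ z : ℂ, ‖z‖ < 1 → Summable fun n : ℕ ↦ z ^ n • c n) {r : ℝ} (hr0 : 0 ≤ r)
    (hr1 : r < 1) : Summable fun n ↦ ‖c n‖ * r ^ n := by
  obtain ⟨ρ, hrρ, hρ1⟩ := exists_between hr1
  have hρ0 : 0 < ρ := hr0.trans_lt hrρ
  have hρ : ‖(ρ : ℂ)‖ = ρ := by rw [Complex.norm_real, Real.norm_of_nonneg hρ0.le]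
  obtain ⟨C, hC⟩ := (h ρ (by rwa [hρ])).tendsto_atTop_zero.norm.bddAbove_range
  refine Summable.of_nonneg_of_le (fun n ↦ by positivity) (fun n ↦ ?_)
    ((summable_geometric_of_lt_one (div_nonneg hr0 hρ0.le) ((div_lt_one hρ0).2 hrρ)).mul_left C)
  have hn : ‖(ρ : ℂ) ^ n • c n‖ ≤ C := hC ⟨n, rfl⟩
  rw [norm_smul, norm_pow, hρ] at hn
  calc ‖c n‖ * r ^ n = (ρ ^ n * ‖c n‖) * (r / ρ) ^ n := by rw [div_pow]; field_simp
    _ ≤ C * (r / ρ) ^ n := by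
      have := div_nonneg hr0 hρ0.le
      gcongr

/-- The operator-valued **Herglotz representation theorem**: a holomorphic function on the unit
disc with `F 0 = 1` and real part at least `1 / 2` is `I* (1 - z U)⁻¹ I` for a unitary `U`. -/
theorem exists_unitary_dilation_of_differentiableOn {F : ℂ → H →L[ℂ] H}
    (hF : DifferentiableOn ℂ F (Metric.ball 0 1)) (h0 : F 0 = 1)
    (hpos : ∀ z : ℂ, ‖z‖ < 1 → ∀ x, ‖x‖ ^ 2 ≤ 2 * (⟪x, F z x⟫).re) :
    ∃ (K : Type u) (_ : NormedAddCommGroup K) (_ : InnerProductSpace ℂ K) (_ : CompleteSpace K)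
      (I : H →ₗᵢ[ℂ] K) (U : K →L[ℂ] K), U ∈ unitary (K →L[ℂ] K) ∧
      ∀ z : ℂ, ‖z‖ < 1 → F z = ContinuousLinearMap.adjoint I.toContinuousLinearMap ∘L
        Ring.inverse (1 - z • U) ∘L I.toContinuousLinearMap := by
  set c : ℕ → H →L[ℂ] H := fun n ↦ (n.factorial : ℂ)⁻¹ • iteratedDeriv n F 0 with hcdef
  have hc0 : c 0 = 1 := by simp [hcdef, h0]
  have hsum : ∀ z : ℂ, ‖z‖ < 1 → HasSum (fun n : ℕ ↦ z ^ n • c n) (F z) := by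
    intro z hz
    have h := Complex.hasSum_taylorSeries_on_ball hF (z := z) (by simpa using hz)
    simpa only [sub_zero, hcdef, smul_comm (z ^ _)] using h
  clear_value c
  obtain ⟨K, _, _, _, I, U, hU, hI⟩ := exists_unitary_dilation_of_posSemidef
    (hermitianExtension c) (by simp [hermitianExtension, hc0])
    (posSemidef_hermitianExtension hc0
      (fun r hr0 hr1 ↦ summable_norm_mul_pow (fun z hz ↦ (hsum z hz).summable) hr0 hr1)
      hsum hF.continuousOn hpos)
  refine ⟨K, inferInstance, inferInstance, inferInstance, I, U, hU, fun z hz ↦ ?_⟩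
  have hgeom : HasSum (fun n : ℕ ↦ (z • U) ^ n) (Ring.inverse (1 - z • U)) :=
    NormedRing.inverse_one_sub _ (norm_smul_lt_one_of_mem_unitary hU hz) ▸
      (summable_geometric_of_norm_lt_one (norm_smul_lt_one_of_mem_unitary hU hz)).hasSum
  ext1 y
  -- Tested against vectors, both sides are power series in `z`; the Naimark identity matches their
  -- coefficients.
  refine ext_inner_left ℂ fun x ↦ ?_
  have h1 := (hsum z hz).mapL ((innerSL ℂ x).comp (ContinuousLinearMap.apply ℂ H y))
  have h2 := hgeom.mapL ((innerSL ℂ (I x)).comp (ContinuousLinearMap.apply ℂ K (I y)))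
  have e : ⟪x, (ContinuousLinearMap.adjoint I.toContinuousLinearMap ∘L
      Ring.inverse (1 - z • U) ∘L I.toContinuousLinearMap) y⟫ =
      ⟪I x, Ring.inverse (1 - z • U) (I y)⟫ := by
    simp [ContinuousLinearMap.adjoint_inner_right]
  rw [e]
  refine h1.unique ?_
  convert! h2 using 2 with n
  have h3 := hI n x y
  simp only [hermitianExtension, Int.natCast_nonneg, if_true, Int.natAbs_natCast] at h3
  rw [smul_pow]
  change ⟪x, (z ^ n • c n) y⟫ = ⟪I x, (z ^ n • U ^ n) (I y)⟫
  rw [smul_apply, smul_apply, inner_smul_right, inner_smul_right, h3]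

end Herglotz

/-! ### From the numerical range to the dilation, and the theorem. -/

section Operators

variable {H : Type u} [NormedAddCommGroup H] [InnerProductSpace ℂ H] [CompleteSpace H]

lemma hasStrangeDilation_of_numericalRange_subset {δ : ℝ} (hδ₀ : 0 ≤ δ) (hδ₁ : δ < 1)
    {T : H →L[ℂ] H} (hT : numericalRange T ⊆ ellipse δ) : HasStrangeDilation δ T :=
  exists_unitary_dilation_of_differentiableOn
    (differentiableOn_dilationFunction fun _ hz ↦
      isUnit_denominator_of_numericalRange_subset hδ₀ hδ₁ hT hz)
    (dilationFunction_zero δ T)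
    fun _ hz x ↦ norm_sq_le_two_mul_inner_dilationFunction hδ₀ hδ₁ hT hz x

end Operators

end EllipseDilation

theorem theorem1p3 {H : Type u} [NormedAddCommGroup H] [InnerProductSpace ℂ H] [CompleteSpace H]
    (δ : ℝ) (hδ₀ : 0 ≤ δ) (hδ₁ : δ < 1) (T : H →L[ℂ] H) :
    (spectrum ℂ T ⊆ EllipseDilation.ellipse δ →
      (∀ z : ℂ, ‖z‖ < 1 → IsUnit (EllipseDilation.denominator δ T z)) ∧
      (EllipseDilation.numericalRange T ⊆ EllipseDilation.ellipse δ ↔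
        EllipseDilation.HasStrangeDilation δ T)) ∧
    (EllipseDilation.numericalRange T ⊆ EllipseDilation.ellipse δ ↔
      (∀ z : ℂ, ‖z‖ < 1 → IsUnit (EllipseDilation.denominator δ T z)) ∧
        EllipseDilation.HasStrangeDilation δ T) := by
  -- Both converses need only invertibility of the denominator: (i) derives it from the spectrum,
  -- (ii) assumes it.
  have main := fun hu : ∀ z : ℂ, ‖z‖ < 1 → IsUnit (EllipseDilation.denominator δ T z) ↦
    EllipseDilation.numericalRange_subset_of_hasStrangeDilation (T := T) hδ₀ hδ₁ hu
  refine ⟨fun hσ ↦ ?_, fun hW ↦ ?_, fun h ↦ main h.1 h.2⟩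
  · have hu := fun (z : ℂ) (hz : ‖z‖ < 1) ↦
      EllipseDilation.isUnit_denominator_of_spectrum_subset hδ₀ hδ₁ hσ hz
    exact ⟨hu, EllipseDilation.hasStrangeDilation_of_numericalRange_subset hδ₀ hδ₁, main hu⟩
  · exact ⟨fun z hz ↦ EllipseDilation.isUnit_denominator_of_numericalRange_subset hδ₀ hδ₁ hW hz,
      EllipseDilation.hasStrangeDilation_of_numericalRange_subset hδ₀ hδ₁ hW⟩
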